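/- Let $k\ge 1$, $n_1,\dots,n_k\ge 1$, $n=\sum_i n_i$, and write $v=(v^{(1)},\dots,v^{(k)})\in\mathbb{R}^n$ with $v^{(i)}\in\mathbb{R}^{n_i}$. Let $\mathcal{K}=\mathcal{K}^1\times\cdots\times\mathcal{K}^k$ with $\mathcal{K}^i=\{u\in\mathbb{R}^{n_i}:u_1\ge\|u_{2:n_i}\|\}$ (the half-line $u_1\ge 0$ if $n_i=1$; an $l$-dimensional linear cone counts as $l$ one-dimensional cones), and $\mathcal{C}=\mathcal{K}\times\mathbb{R}^p\times\mathcal{K}$. The Jordan product $x\circ s$ has blocks $\big((x^{(i)})^Ts^{(i)},\ x^{(i)}_1s^{(i)}_{2:n_i}+s^{(i)}_1x^{(i)}_{2:n_i}\big)$, with unit $e$ whose blocks are $(1,0,\dots,0)$. Let $\mathrm{mat}(v)$ be the block diagonal matrix with blocks $\begin{pmatrix}v^{(i)}_1&(v^{(i)}_{2:n_i})^T\\ v^{(i)}_{2:n_i}&v^{(i)}_1I\end{pmatrix}$. For $x\in\mathrm{int}(\mathcal{K})$ let $T_x$ be the block diagonal matrix with blocks $T_{x^{(i)}}$, where $$T_u=\begin{pmatrix}u_1&u_{2:n_i}^T\\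 u_{2:n_i}&\beta_uI+\dfrac{u_{2:n_i}u_{2:n_i}^T}{\beta_u+u_1}\end{pmatrix},\qquad \beta_u=\sqrt{u_1^2-\|u_{2:n_i}\|^2}.$$ Put $\mu(x,s)=x^Ts/k$, $d_2(x,s)=\sqrt2\,\|T_xs-\mu(x,s)e\|$ and $$\mathcal{N}_2(\gamma)=\{(x,y,s)\in\mathrm{int}(\mathcal{C}): d_2(x,s)\le\gamma\,\mu(x,s)\}.$$ Let $A\in\mathbb{R}^{p\times n}$ with $\mathrm{rank}(A)=p$, let $C\in\mathbb{R}^{n\times n}$ with $C=-C^T$, and let $\hat r_p=Ax$, $\hat r_d=A^Ty+Cx+s$. **Theorem.** Let $\gamma\in(0,1/3)$, $\delta\in(0,1)$, $\alpha\in[0,1]$, $\nu=1-\delta/\sqrt{2k}$, and suppose that $$\tilde\Gamma=\frac{4(\gamma^2+\delta^2)}{(1-3\gamma)^2}\left(1-\frac{\delta}{\sqrt{2k}}\right)^{-1}<\gamma.$$ Let $(x,y,s)\in\mathcal{N}_2(\gamma)$ and let $(\Delta x,\Delta y,\Delta s)$ be the solution of the linear system with unscaled direction ($D=I$) $$A\Delta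 x=-(1-\nu)Ax,\qquad A^T\Delta y+C\Delta x+\Delta s=-(1-\nu)(A^Ty+Cx+s),$$ $$\mathrm{mat}(x)\Delta s+\mathrm{mat}(s)\Delta x=\nu\,\mu(x,s)\,e-x\circ s.$$ Then the point $(x(\alpha),y(\alpha),s(\alpha))=(x+\alpha\Delta x,\,y+\alpha\Delta y,\,s+\alpha\Delta s)$ lies in $\mathcal{N}_2(\gamma)$, and its residuals $\hat r_p(\alpha),\hat r_d(\alpha)$ and its $\mu(\alpha)=\mu(x(\alpha),s(\alpha))$ satisfy $$\hat r_p(\alpha)=\Big(1-\frac{\alpha\delta}{\sqrt{2k}}\Big)\hat r_p,\qquad \hat r_d(\alpha)=\Big(1-\frac{\alpha\delta}{\sqrt{2k}}\Big)\hat r_d,\qquad \mu(\alpha)=\Big(1-\frac{\alpha\delta}{\sqrt{2k}}\Big)\mu(x,s).$$ -/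

import Mathlib

open Matrix

noncomputable section

namespace SOCP

/-- Euclidean norm of a finite real vector. -/
def eucNorm {ι : Type*} [Fintype ι] (v : ι → ℝ) : ℝ := ‖WithLp.toLp 2 v‖

/-- Positions of the coordinates of `ℝⁿ`, `n = ∑ i, n_i`, split into `k` blocks, the `i`-th of
dimension `n_i = d i + 1 ≥ 1`. -/
abbrev Idx {k : ℕ} (d : Fin k → ℕ) : Type := Σ i : Fin k, Fin (d i + 1)

/-- The space `ℝⁿ`, with its coordinates grouped into blocks. -/
abbrev Vec {k : ℕ} (d : Fin k → ℕ) : Type := Idx d → ℝ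

/-- The subvector `v⁽ⁱ⁾`. -/
def block {k : ℕ} {d : Fin k → ℕ} (v : Vec d) (i : Fin k) : Fin (d i + 1) → ℝ :=
  fun a => v ⟨i, a⟩

/-- The vector with given blocks. -/
def ofBlocks {k : ℕ} {d : Fin k → ℕ} (f : (i : Fin k) → Fin (d i + 1) → ℝ) : Vec d :=
  fun j => f j.1 j.2

/-- The second-order cone `{v ∈ ℝ^(m+1) : v₁ ≥ ‖v_{2:m+1}‖}`; for `m = 0` it is the half-line
`{v : v₁ ≥ 0}`, i.e. the one-dimensional linear cone. -/
def soCone (m : ℕ) : Set (Fin (m + 1) → ℝ) := {v | eucNorm (Fin.tail v) ≤ v 0}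

/-- The product `𝒦` of the `k` cones. A linear cone of dimension `l` is `l` one-dimensional blocks. -/
def cone {k : ℕ} (d : Fin k → ℕ) : Set (Vec d) := {v | ∀ i, block v i ∈ soCone (d i)}

/-- Jordan product on one block. -/
def jordanBlock {m : ℕ} (u v : Fin (m + 1) → ℝ) : Fin (m + 1) → ℝ :=
  Fin.cons (u ⬝ᵥ v) (u 0 • Fin.tail v + v 0 • Fin.tail u)

/-- The Jordan product `x ∘ s` on `ℝⁿ`. -/
def jordan {k : ℕ} {d : Fin k → ℕ} (x s : Vec d) : Vec d :=
  ofBlocks fun i => jordanBlock (block x i) (block s i)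

/-- The unit element `e`. -/
def unitVec {k : ℕ} (d : Fin k → ℕ) : Vec d := ofBlocks fun _ => Pi.single 0 1

/-- Arrow head matrix of one block. -/
def arrowBlock {m : ℕ} (u : Fin (m + 1) → ℝ) : Matrix (Fin (m + 1)) (Fin (m + 1)) ℝ :=
  Matrix.of (Fin.cons (Fin.cons (u 0) (Fin.tail u))
    fun a => Fin.cons (Fin.tail u a) ((u 0 • (1 : Matrix (Fin m) (Fin m) ℝ)) a))

/-- The arrow head matrix `mat(v)`. -/
def arrow {k : ℕ} {d : Fin k → ℕ} (v : Vec d) : Matrix (Idx d) (Idx d) ℝ :=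
  Matrix.blockDiagonal' fun i => arrowBlock (block v i)

/-- `β_u = √(u₁² - ‖u_{2:n}‖²)`. -/
def beta {m : ℕ} (u : Fin (m + 1) → ℝ) : ℝ := √(u 0 ^ 2 - eucNorm (Fin.tail u) ^ 2)

/-- The matrix `T_u` of one block. -/
def scaleBlock {m : ℕ} (u : Fin (m + 1) → ℝ) : Matrix (Fin (m + 1)) (Fin (m + 1)) ℝ :=
  Matrix.of (Fin.cons (Fin.cons (u 0) (Fin.tail u))
    fun a => Fin.cons (Fin.tail u a)
      ((beta u • (1 : Matrix (Fin m) (Fin m) ℝ)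
        + (beta u + u 0)⁻¹ • Matrix.vecMulVec (Fin.tail u) (Fin.tail u)) a))

/-- The scaling matrix `T_v`. -/
def scaleMat {k : ℕ} {d : Fin k → ℕ} (v : Vec d) : Matrix (Idx d) (Idx d) ℝ :=
  Matrix.blockDiagonal' fun i => scaleBlock (block v i)

/-- `w_{xs} = T_x s`. -/
def wVec {k : ℕ} {d : Fin k → ℕ} (x s : Vec d) : Vec d := scaleMat x *ᵥ s

/-- The central path coefficient `μ(x, s) = xᵀ s / k`. -/
def mu {k : ℕ} {d : Fin k → ℕ} (x s : Vec d) : ℝ := (x ⬝ᵥ s) / (k : ℝ)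

/-- The central path distance `d₂(x, s) = √2 ‖w_{xs} - μ e‖`. -/
def dist₂ {k : ℕ} {d : Fin k → ℕ} (x s : Vec d) : ℝ :=
  √2 * eucNorm (wVec x s - mu x s • unitVec d)

/-- The space of points `(x, y, s)`. -/
abbrev Point {k : ℕ} (d : Fin k → ℕ) (p : ℕ) : Type := Vec d × (Fin p → ℝ) × Vec d

/-- `𝒞 = 𝒦 × ℝᵖ × 𝒦`. -/
def fullCone {k : ℕ} (d : Fin k → ℕ) (p : ℕ) : Set (Point d p) :=
  cone d ×ˢ (Set.univ ×ˢ cone d)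

/-- The neighborhood `𝒩₂(γ)` of the central path. -/
def nbhd₂ {k : ℕ} (d : Fin k → ℕ) (p : ℕ) (γ : ℝ) : Set (Point d p) :=
  {z | z ∈ interior (fullCone d p) ∧ dist₂ z.1 z.2.2 ≤ γ * mu z.1 z.2.2}

/-- The residual `r̂_p = A x`. -/
def resP {k p : ℕ} {d : Fin k → ℕ} (A : Matrix (Fin p) (Idx d) ℝ) (z : Point d p) : Fin p → ℝ :=
  A *ᵥ z.1

/-- The residual `r̂_d = Aᵀ y + C x + s`. -/
def resD {k p : ℕ} {d : Fin k → ℕ} (A : Matrix (Fin p) (Idx d) ℝ)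
    (C : Matrix (Idx d) (Idx d) ℝ) (z : Point d p) : Vec d :=
  Aᵀ *ᵥ z.2.1 + C *ᵥ z.1 + z.2.2

/-- `Δz = (Δx, Δy, Δs)` solves the generalized linear system at the point `z = (x, y, s)` with
(invertible) scaling matrix `D` and parameter `ν`; here `x̄ = D⁻ᵀ x` and `s̄ = D s`. -/
structure IsDirection {k p : ℕ} {d : Fin k → ℕ} (A : Matrix (Fin p) (Idx d) ℝ)
    (C D : Matrix (Idx d) (Idx d) ℝ) (ν : ℝ) (z Δz : Point d p) : Prop where
  primal : A *ᵥ Δz.1 = -(1 - ν) • (A *ᵥ z.1)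
  dual : Aᵀ *ᵥ Δz.2.1 + C *ᵥ Δz.1 + Δz.2.2
    = -(1 - ν) • (Aᵀ *ᵥ z.2.1 + C *ᵥ z.1 + z.2.2)
  compl : arrow (D⁻¹ᵀ *ᵥ z.1) *ᵥ (D *ᵥ Δz.2.2) + arrow (D *ᵥ z.2.2) *ᵥ (D⁻¹ᵀ *ᵥ Δz.1)
    = (ν * mu z.1 z.2.2) • unitVec d - jordan (D⁻¹ᵀ *ᵥ z.1) (D *ᵥ z.2.2)

end SOCP

end

open Matrix

noncomputable section

namespace SOCP

/-! Everything is measured in coordinates scaled by `T_x`: write `Δx = T_x u`, `v = T_x Δs`, `w =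
T_x s`, `G = w - μ e`. If scaling commuted with the Jordan product, the complementarity equation
would read `w + v + u ∘ w = ν μ e`. It does not, but the defect `R = w + v + u ∘ w - ν μ e` is of
second order, `‖R‖ ≤ 2 ‖u‖ ‖G‖`. This is the crux (`jordanBlock_triple`, `scaled_residual_sq_le`).

Skew-symmetry of `C` gives `Δx ⬝ᵥ Δs = 0`. Hence `μ` is exactly linear in `α`, and `u ⬝ᵥ v = 0`, so
`‖v + μ u‖² = ‖v‖² + μ² ‖u‖²`. Since `v + μ u = R - u ∘ G - (G + (1 - ν) μ e)`, the terms containing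
`u` on the right can be absorbed, which bounds `u` and `v` (`scaled_direction_bound`).

Finally `x(α) = T_x (e + α u)` and `T_x s(α) = w + α v`. Passing from `T_{x(α)} s(α)` to the Jordan
product `(e + α u) ∘ (w + α v)` does not decrease the distance to a multiple of `e`
(`scaleBlock_sub_sq_le`), and that product minus `μ(α) e` equals `(1 - α) G + α R + α² u ∘ v`. Each
term is small enough for membership in the neighborhood. -/

theorem eucNorm_sq {ι : Type*} [Fintype ι] (v : ι → ℝ) : eucNorm v ^ 2 = v ⬝ᵥ v := by
  rw [eucNorm, EuclideanSpace.norm_sq_eq]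
  simp [dotProduct, pow_two]

theorem eucNorm_nonneg {ι : Type*} [Fintype ι] (v : ι → ℝ) : 0 ≤ eucNorm v := norm_nonneg _

theorem eucNorm_add_le {ι : Type*} [Fintype ι] (u v : ι → ℝ) :
    eucNorm (u + v) ≤ eucNorm u + eucNorm v := by
  simpa [eucNorm] using norm_add_le (WithLp.toLp 2 u) (WithLp.toLp 2 v)

theorem eucNorm_smul {ι : Type*} [Fintype ι] (c : ℝ) (v : ι → ℝ) :
    eucNorm (c • v) = |c| * eucNorm v := by
  simpa [eucNorm] using norm_smul c (WithLp.toLp 2 v)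

theorem dotProduct_self_nonneg' {ι : Type*} [Fintype ι] (v : ι → ℝ) : 0 ≤ v ⬝ᵥ v := by
  rw [← eucNorm_sq]; positivity

theorem dotProduct_sq_le {ι : Type*} [Fintype ι] (u v : ι → ℝ) :
    (u ⬝ᵥ v) ^ 2 ≤ (u ⬝ᵥ u) * (v ⬝ᵥ v) := by
  simpa [dotProduct, pow_two] using Finset.sum_mul_sq_le_sq_mul_sq Finset.univ u v

/-! ### Jordan algebra and scaling on a single second-order cone. -/

section Block

variable {m : ℕ}

/-- Interior points of the second-order cone. -/
def PosBlock (u : Fin (m + 1) → ℝ) : Prop :=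
  0 < u 0 ∧ Fin.tail u ⬝ᵥ Fin.tail u < u 0 ^ 2

theorem eucNorm_tail_lt_iff (u : Fin (m + 1) → ℝ) :
    eucNorm (Fin.tail u) < u 0 ↔ PosBlock u := by
  have h := eucNorm_nonneg (Fin.tail u)
  rw [PosBlock, ← eucNorm_sq]
  constructor
  · intro h'
    exact ⟨by linarith, by nlinarith⟩
  · rintro ⟨h0, h1⟩
    exact lt_of_pow_lt_pow_left₀ 2 h0.le h1

theorem dotProduct_eq_tail (u v : Fin (m + 1) → ℝ) :
    u ⬝ᵥ v = u 0 * v 0 + Fin.tail u ⬝ᵥ Fin.tail v := by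
  simp [dotProduct, Fin.sum_univ_succ, Fin.tail]

theorem block_ext {u v : Fin (m + 1) → ℝ} (h0 : u 0 = v 0) (h : Fin.tail u = Fin.tail v) :
    u = v := by
  rw [← Fin.cons_self_tail u, ← Fin.cons_self_tail v, h0, h]

theorem tail_sub' (u v : Fin (m + 1) → ℝ) : Fin.tail (u - v) = Fin.tail u - Fin.tail v := rfl
theorem tail_smul' (c : ℝ) (u : Fin (m + 1) → ℝ) : Fin.tail (c • u) = c • Fin.tail u := rfl

/-- The unit element of one block. -/
abbrev unitBlock : Fin (m + 1) → ℝ := Pi.single 0 1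

theorem tail_unitBlock : Fin.tail (unitBlock : Fin (m + 1) → ℝ) = 0 := by
  ext a; simp [Fin.tail]

@[simp] theorem jordanBlock_zero (u v : Fin (m + 1) → ℝ) : jordanBlock u v 0 = u ⬝ᵥ v := rfl
@[simp] theorem tail_jordanBlock (u v : Fin (m + 1) → ℝ) :
    Fin.tail (jordanBlock u v) = u 0 • Fin.tail v + v 0 • Fin.tail u := rfl

theorem jordanBlock_comm (u v : Fin (m + 1) → ℝ) : jordanBlock u v = jordanBlock v u :=
  block_ext (by simp [dotProduct_comm]) (by simp [add_comm])

theorem arrowBlock_mulVec (u v : Fin (m + 1) → ℝ) : arrowBlock u *ᵥ v = jordanBlock u v := by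
  apply block_ext
  · simp [arrowBlock, mulVec, dotProduct, Fin.sum_univ_succ, Fin.tail]
  · ext a
    simp [arrowBlock, jordanBlock, mulVec, dotProduct, Fin.sum_univ_succ, Fin.tail,
      Matrix.one_apply]
    ring

@[simp] theorem scaleBlock_mulVec_zero (u v : Fin (m + 1) → ℝ) :
    (scaleBlock u *ᵥ v) 0 = u ⬝ᵥ v := by
  simp [scaleBlock, mulVec, dotProduct, Fin.sum_univ_succ, Fin.tail]

@[simp] theorem tail_scaleBlock_mulVec (u v : Fin (m + 1) → ℝ) :
    Fin.tail (scaleBlock u *ᵥ v) = beta u • Fin.tail v +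
      (v 0 + (beta u + u 0)⁻¹ * (Fin.tail u ⬝ᵥ Fin.tail v)) • Fin.tail u := by
  ext a
  simp [scaleBlock, mulVec, dotProduct, Fin.sum_univ_succ, Fin.tail, Matrix.one_apply,
    vecMulVec_apply, add_mul, Finset.sum_add_distrib, Finset.mul_sum, Finset.sum_mul]
  rw [add_left_comm]
  congr 2
  · ring
  · exact Finset.sum_congr rfl fun i _ => by ring

theorem beta_sq {u : Fin (m + 1) → ℝ} (hu : PosBlock u) :
    beta u ^ 2 = u 0 ^ 2 - Fin.tail u ⬝ᵥ Fin.tail u := by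
  rw [beta, eucNorm_sq, Real.sq_sqrt (sub_nonneg.2 hu.2.le)]

theorem beta_pos {u : Fin (m + 1) → ℝ} (hu : PosBlock u) : 0 < beta u := by
  rw [beta, eucNorm_sq]
  exact Real.sqrt_pos.2 (sub_pos.2 hu.2)

theorem beta_inv_mul {u : Fin (m + 1) → ℝ} (hu : PosBlock u) :
    (beta u + u 0)⁻¹ * (Fin.tail u ⬝ᵥ Fin.tail u) = u 0 - beta u := by
  have := beta_sq hu
  have := beta_pos hu
  have := hu.1
  field_simp
  linarith

/-- The determinant of one block of the Jordan algebra. -/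
def blockDet (u : Fin (m + 1) → ℝ) : ℝ := u 0 ^ 2 - Fin.tail u ⬝ᵥ Fin.tail u

/-- `T_u` is the quadratic representation of the Jordan square root of `u`, so it multiplies
determinants by `det u`. The check uses only `β² = u₀² - ‖u'‖²` and the defining property of `(β +
u₀)⁻¹`. -/
theorem blockDet_scaleBlock {u : Fin (m + 1) → ℝ} (hu : PosBlock u) (v : Fin (m + 1) → ℝ) :
    blockDet (scaleBlock u *ᵥ v) = blockDet u * blockDet v := by
  have h1 := beta_inv_mul hu
  have h2 := beta_sq hu
  simp only [blockDet, scaleBlock_mulVec_zero, tail_scaleBlock_mulVec, dotProduct_add,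
    add_dotProduct, dotProduct_smul, smul_dotProduct, smul_eq_mul, dotProduct_eq_tail u v,
    dotProduct_comm (Fin.tail v) (Fin.tail u)]
  have h3 : (beta u + u 0)⁻¹ * (beta u + u 0) = 1 :=
    inv_mul_cancel₀ (by have := beta_pos hu; have := hu.1; positivity)
  generalize (beta u + u 0)⁻¹ = r at *
  generalize Fin.tail u ⬝ᵥ Fin.tail u = q at *
  generalize Fin.tail u ⬝ᵥ Fin.tail v = p at *
  generalize Fin.tail v ⬝ᵥ Fin.tail v = t at *
  generalize beta u = β at *
  generalize u 0 = a at *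
  generalize v 0 = b at *
  have hq : q = a ^ 2 - β ^ 2 := by linarith
  subst hq
  have h4 : r * (a ^ 2 - β ^ 2) = a - β := h1
  linear_combination (-p * (2 * b + r * p)) * h4 - p ^ 2 * h3

theorem PosBlock.dotProduct_pos {u v : Fin (m + 1) → ℝ} (hu : PosBlock u) (hv : PosBlock v) :
    0 < u ⬝ᵥ v := by
  rw [dotProduct_eq_tail]
  have h := dotProduct_sq_le (Fin.tail u) (Fin.tail v)
  have h0 := dotProduct_self_nonneg' (Fin.tail v)
  have h1 : (Fin.tail u ⬝ᵥ Fin.tail v) ^ 2 < (u 0 * v 0) ^ 2 := by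
    have := hu.2; have := hv.2; have := pow_pos hu.1 2
    nlinarith
  have := abs_lt_of_sq_lt_sq h1 (mul_pos hu.1 hv.1).le
  linarith [(abs_lt.1 this).1]

theorem PosBlock.scale {u v : Fin (m + 1) → ℝ} (hu : PosBlock u) (hv : PosBlock v) :
    PosBlock (scaleBlock u *ᵥ v) := by
  refine ⟨by simpa using hu.dotProduct_pos hv, ?_⟩
  have h := blockDet_scaleBlock hu v
  have : 0 < blockDet u * blockDet v := mul_pos (sub_pos.2 hu.2) (sub_pos.2 hv.2)
  rw [← h, blockDet] at this
  linarith

/-- Conjugation in one block of the Jordan algebra. -/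
def conjBlock (u : Fin (m + 1) → ℝ) : Fin (m + 1) → ℝ := Fin.cons (u 0) (-Fin.tail u)

@[simp] theorem conjBlock_zero (u : Fin (m + 1) → ℝ) : conjBlock u 0 = u 0 := rfl
@[simp] theorem tail_conjBlock (u : Fin (m + 1) → ℝ) :
    Fin.tail (conjBlock u) = -Fin.tail u := rfl
@[simp] theorem conjBlock_conjBlock (u : Fin (m + 1) → ℝ) : conjBlock (conjBlock u) = u :=
  block_ext rfl (by simp)

theorem PosBlock.conj {u : Fin (m + 1) → ℝ} (hu : PosBlock u) : PosBlock (conjBlock u) := by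
  simpa [PosBlock] using hu

@[simp] theorem beta_conjBlock (u : Fin (m + 1) → ℝ) : beta (conjBlock u) = beta u := by
  simp [beta, eucNorm_sq]

/-- The conjugate of `u` is `det u` times its Jordan inverse, so up to the factor `β²` its scaling
matrix inverts `T_u`. This yields surjectivity of `T_u` and shows that the inverse preserves the
open cone. -/
theorem scaleBlock_conj_mulVec {u : Fin (m + 1) → ℝ} (hu : PosBlock u) (v : Fin (m + 1) → ℝ) :
    scaleBlock (conjBlock u) *ᵥ (scaleBlock u *ᵥ v) = beta u ^ 2 • v := by
  have h1 := beta_inv_mul hu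
  have h2 := beta_sq hu
  have h3 : (beta u + u 0)⁻¹ * (beta u + u 0) = 1 :=
    inv_mul_cancel₀ (by have := beta_pos hu; have := hu.1; positivity)
  apply block_ext
  · simp only [scaleBlock_mulVec_zero, dotProduct_eq_tail, tail_conjBlock, conjBlock_zero,
      tail_scaleBlock_mulVec, neg_dotProduct, dotProduct_add, dotProduct_smul, smul_eq_mul,
      Pi.smul_apply]
    generalize (beta u + u 0)⁻¹ = r at *
    linear_combination (-(Fin.tail u ⬝ᵥ Fin.tail v)) * h1 - v 0 * h2
  · simp only [tail_smul', tail_scaleBlock_mulVec, beta_conjBlock, conjBlock_zero, tail_conjBlock,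
      scaleBlock_mulVec_zero, dotProduct_eq_tail u v, neg_dotProduct, dotProduct_add,
      dotProduct_smul, smul_eq_mul]
    ext a
    simp only [Pi.add_apply, Pi.smul_apply, Pi.neg_apply, smul_eq_mul]
    generalize (beta u + u 0)⁻¹ = r at *
    linear_combination (Fin.tail u a * (v 0 + r * (Fin.tail u ⬝ᵥ Fin.tail v))) * h1
      + (Fin.tail u a * (Fin.tail u ⬝ᵥ Fin.tail v)) * h3

theorem exists_scaleBlock_mulVec_eq {u : Fin (m + 1) → ℝ} (hu : PosBlock u)
    (v : Fin (m + 1) → ℝ) : ∃ y, scaleBlock u *ᵥ y = v := by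
  refine ⟨(beta u ^ 2)⁻¹ • (scaleBlock (conjBlock u) *ᵥ v), ?_⟩
  have h := scaleBlock_conj_mulVec hu.conj v
  rw [conjBlock_conjBlock, beta_conjBlock] at h
  rw [mulVec_smul, h, smul_smul, inv_mul_cancel₀ (pow_pos (beta_pos hu) 2).ne', one_smul]

theorem PosBlock.smul {u : Fin (m + 1) → ℝ} (hu : PosBlock u) {c : ℝ} (hc : 0 < c) :
    PosBlock (c • u) := by
  refine ⟨mul_pos hc hu.1, ?_⟩
  have := mul_lt_mul_of_pos_left hu.2 (pow_pos hc 2)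
  simp only [tail_smul', dotProduct_smul, smul_dotProduct, smul_eq_mul, Pi.smul_apply]
  linarith

theorem PosBlock.of_scale {u v : Fin (m + 1) → ℝ} (hu : PosBlock u)
    (hv : PosBlock (scaleBlock u *ᵥ v)) : PosBlock v := by
  have hb := pow_pos (beta_pos hu) 2
  have h := (hu.conj.scale hv).smul (inv_pos.2 hb)
  rwa [scaleBlock_conj_mulVec hu, smul_smul, inv_mul_cancel₀ hb.ne', one_smul] at h

theorem scaleBlock_mulVec_unit (u : Fin (m + 1) → ℝ) : scaleBlock u *ᵥ unitBlock = u := by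
  apply block_ext
  · simp
  · simp only [tail_scaleBlock_mulVec, tail_unitBlock]
    simp

theorem scaleBlock_symm (u v w : Fin (m + 1) → ℝ) :
    v ⬝ᵥ (scaleBlock u *ᵥ w) = (scaleBlock u *ᵥ v) ⬝ᵥ w := by
  rw [dotProduct_eq_tail v, dotProduct_eq_tail _ w]
  simp only [scaleBlock_mulVec_zero, tail_scaleBlock_mulVec, dotProduct_eq_tail u,
    add_dotProduct, dotProduct_add, dotProduct_smul, smul_dotProduct, smul_eq_mul,
    dotProduct_comm _ (Fin.tail u)]
  ring

/-- `mat(u)` and `T_u` commute, being built from the same element `u`. -/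
theorem jordanBlock_scaleBlock {u : Fin (m + 1) → ℝ} (hu : PosBlock u) (v : Fin (m + 1) → ℝ) :
    jordanBlock u (scaleBlock u *ᵥ v) = scaleBlock u *ᵥ jordanBlock u v := by
  have h1 := beta_inv_mul hu
  apply block_ext
  · simp only [jordanBlock_zero, scaleBlock_mulVec_zero, dotProduct_eq_tail u,
      tail_scaleBlock_mulVec, tail_jordanBlock, dotProduct_add, dotProduct_smul, smul_eq_mul]
    linear_combination (Fin.tail u ⬝ᵥ Fin.tail v) * h1
  · simp only [tail_scaleBlock_mulVec, tail_jordanBlock, jordanBlock_zero,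
      scaleBlock_mulVec_zero, dotProduct_eq_tail u, dotProduct_add, dotProduct_smul, smul_eq_mul]
    ext a
    simp only [Pi.add_apply, Pi.smul_apply, smul_eq_mul]
    linear_combination (-Fin.tail u a * v 0) * h1

/-- This measures how far scaling is from commuting with the Jordan product. The defect has no
leading component, and its tail is antisymmetric in the tails of `u` and `T_x s`, hence orthogonal
to the tail of `x`. -/
theorem jordanBlock_triple {x : Fin (m + 1) → ℝ} (hx : PosBlock x) (u s : Fin (m + 1) → ℝ) :
    jordanBlock x (jordanBlock u (scaleBlock x *ᵥ s))
      - scaleBlock x *ᵥ jordanBlock s (scaleBlock x *ᵥ u)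
    = Fin.cons 0 ((Fin.tail x ⬝ᵥ Fin.tail (scaleBlock x *ᵥ s)) • Fin.tail u
        - (Fin.tail x ⬝ᵥ Fin.tail u) • Fin.tail (scaleBlock x *ᵥ s)) := by
  have h1 := beta_inv_mul hx
  have h2 := beta_sq hx
  have h3 : (beta x + x 0)⁻¹ * (beta x + x 0) = 1 :=
    inv_mul_cancel₀ (by have := beta_pos hx; have := hx.1; positivity)
  apply block_ext
  · simp only [Pi.sub_apply, jordanBlock_zero, scaleBlock_mulVec_zero, dotProduct_eq_tail,
      tail_scaleBlock_mulVec, tail_jordanBlock, dotProduct_add, dotProduct_smul, smul_eq_mul,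
      Fin.cons_zero, dotProduct_comm _ (Fin.tail x), dotProduct_comm (Fin.tail s) (Fin.tail u)]
    generalize (beta x + x 0)⁻¹ = r at *
    generalize Fin.tail x ⬝ᵥ Fin.tail x = q at *
    generalize Fin.tail x ⬝ᵥ Fin.tail u = xu at *
    generalize Fin.tail x ⬝ᵥ Fin.tail s = xs at *
    generalize Fin.tail u ⬝ᵥ Fin.tail s = us at *
    generalize beta x = β at *
    generalize x 0 = x0 at *
    obtain rfl : q = x0 ^ 2 - β ^ 2 := by linarith
    have h4 : β + x0 ≠ 0 := right_ne_zero_of_mul_eq_one h3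
    obtain rfl : r = (β + x0)⁻¹ := eq_inv_of_mul_eq_one_left h3
    field_simp
    ring
  · simp only [tail_sub', tail_scaleBlock_mulVec, tail_jordanBlock, jordanBlock_zero,
      scaleBlock_mulVec_zero, dotProduct_eq_tail, dotProduct_add, dotProduct_smul, smul_eq_mul,
      Fin.tail_cons, dotProduct_comm _ (Fin.tail x), dotProduct_comm (Fin.tail s) (Fin.tail u)]
    ext a
    simp only [Pi.add_apply, Pi.sub_apply, Pi.smul_apply, smul_eq_mul]
    generalize (beta x + x 0)⁻¹ = r at *
    generalize Fin.tail x ⬝ᵥ Fin.tail x = q at *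
    generalize Fin.tail x ⬝ᵥ Fin.tail u = xu at *
    generalize Fin.tail x ⬝ᵥ Fin.tail s = xs at *
    generalize Fin.tail u ⬝ᵥ Fin.tail s = us at *
    generalize beta x = β at *
    generalize x 0 = x0 at *
    generalize u 0 = u0 at *
    generalize s 0 = s0 at *
    generalize Fin.tail x a = X at *
    generalize Fin.tail u a = U at *
    generalize Fin.tail s a = S at *
    obtain rfl : q = x0 ^ 2 - β ^ 2 := by linarith
    have h4 : β + x0 ≠ 0 := right_ne_zero_of_mul_eq_one h3
    obtain rfl : r = (β + x0)⁻¹ := eq_inv_of_mul_eq_one_left h3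
    field_simp
    ring

/-- In one block, the residual of the linearized complementarity equation, scaled by `T_x`, is
controlled by the commutator of the scaled factors. -/
theorem scaled_residual_sq_le {x : Fin (m + 1) → ℝ} (hx : PosBlock x)
    (u s t : Fin (m + 1) → ℝ) (c : ℝ)
    (h : jordanBlock x t + jordanBlock s (scaleBlock x *ᵥ u) = c • unitBlock - jordanBlock x s)
    (R : Fin (m + 1) → ℝ)
    (hR : R = scaleBlock x *ᵥ s + scaleBlock x *ᵥ t + jordanBlock u (scaleBlock x *ᵥ s)
      - c • unitBlock) :
    R ⬝ᵥ R ≤ 4 * (u ⬝ᵥ u) * (Fin.tail (scaleBlock x *ᵥ s) ⬝ᵥ Fin.tail (scaleBlock x *ᵥ s)) := by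
  have hadd : ∀ a b : Fin (m + 1) → ℝ, jordanBlock x (a + b) = jordanBlock x a + jordanBlock x b :=
    fun a b => by simp only [← arrowBlock_mulVec, mulVec_add]
  have hsub : ∀ a b : Fin (m + 1) → ℝ, jordanBlock x (a - b) = jordanBlock x a - jordanBlock x b :=
    fun a b => by simp only [← arrowBlock_mulVec, mulVec_sub]
  -- Multiplying `R` by `x` turns the complementarity equation, scaled by `T_x`, into a cancellation
  -- of all terms but the commutator.
  have key : jordanBlock x R = Fin.cons 0
      ((Fin.tail x ⬝ᵥ Fin.tail (scaleBlock x *ᵥ s)) • Fin.tail u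
        - (Fin.tail x ⬝ᵥ Fin.tail u) • Fin.tail (scaleBlock x *ᵥ s)) := by
    rw [← jordanBlock_triple hx, hR, hsub, hadd, hadd, jordanBlock_scaleBlock hx,
      jordanBlock_scaleBlock hx]
    have h' : jordanBlock s (scaleBlock x *ᵥ u) =
        c • unitBlock - jordanBlock x s - jordanBlock x t := by rw [← h]; abel
    have hxe : jordanBlock x (c • unitBlock) = scaleBlock x *ᵥ (c • unitBlock) := by
      rw [mulVec_smul, scaleBlock_mulVec_unit, ← arrowBlock_mulVec, mulVec_smul,
        arrowBlock_mulVec]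
      congr 1
      apply block_ext
      · simp
      · simp [tail_unitBlock]
    rw [h', mulVec_sub, mulVec_sub, hxe]
    abel
  generalize scaleBlock x *ᵥ s = w at *
  have k0 := congrFun key 0
  have k1 := congrArg Fin.tail key
  simp only [jordanBlock_zero, Fin.cons_zero, tail_jordanBlock, Fin.tail_cons,
    dotProduct_eq_tail] at k0 k1
  set x' := Fin.tail x
  set u' := Fin.tail u
  set w' := Fin.tail w
  set R' := Fin.tail R
  have hq := hx.2
  have h0 := hx.1
  have k2 := congrArg (x' ⬝ᵥ ·) k1
  simp only [dotProduct_add, dotProduct_sub, dotProduct_smul, smul_eq_mul] at k2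
  -- The tail of `x ∘ R` is orthogonal to `x'`; together with its zero leading entry this gives `R₀
  -- det x = 0`.
  have hR0 : R 0 = 0 := by
    have : R 0 * (x 0 ^ 2 - x' ⬝ᵥ x') = 0 := by linear_combination x 0 * k0 - k2
    exact (mul_eq_zero.1 this).resolve_right (sub_pos.2 hq).ne'
  rw [hR0, zero_smul, add_zero] at k1
  have k3 := congrArg (fun v => v ⬝ᵥ v) k1
  simp only [dotProduct_sub, sub_dotProduct, dotProduct_smul, smul_dotProduct, smul_eq_mul,
    dotProduct_comm w' u'] at k3
  have c1 := dotProduct_sq_le x' u'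
  have c2 := dotProduct_sq_le x' w'
  have nu := dotProduct_self_nonneg' u'
  have nw := dotProduct_self_nonneg' w'
  have ns := dotProduct_self_nonneg' ((x' ⬝ᵥ u') • w' + (x' ⬝ᵥ w') • u')
  simp only [dotProduct_add, add_dotProduct, dotProduct_smul, smul_dotProduct, smul_eq_mul,
    dotProduct_comm w' u'] at ns
  rw [dotProduct_eq_tail R, hR0, dotProduct_eq_tail u]
  -- `‖a - b‖² ≤ 2‖a‖² + 2‖b‖²` (from `ns`), then Cauchy-Schwarz on each term. The factor `‖x'‖²` is
  -- afterwards cancelled against `x₀²`.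
  have b1 : x 0 ^ 2 * (R' ⬝ᵥ R') ≤ 4 * ((x' ⬝ᵥ x') * (u' ⬝ᵥ u') * (w' ⬝ᵥ w')) := by
    nlinarith [mul_le_mul_of_nonneg_right c1 nw, mul_le_mul_of_nonneg_right c2 nu]
  have b2 : x 0 ^ 2 * (R' ⬝ᵥ R') ≤ x 0 ^ 2 * (4 * ((u' ⬝ᵥ u') * (w' ⬝ᵥ w'))) := by
    nlinarith [mul_le_mul_of_nonneg_right hq.le (mul_nonneg nu nw)]
  have b3 := le_of_mul_le_mul_left b2 (pow_pos h0 2)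
  nlinarith [mul_nonneg (mul_self_nonneg (u 0)) nw]

theorem jordanBlock_sq_le (u v : Fin (m + 1) → ℝ) :
    jordanBlock u v ⬝ᵥ jordanBlock u v ≤ 2 * ((u ⬝ᵥ u) * (v ⬝ᵥ v)) := by
  rw [dotProduct_eq_tail (jordanBlock u v), tail_jordanBlock, jordanBlock_zero,
    dotProduct_eq_tail u v, dotProduct_eq_tail u u, dotProduct_eq_tail v v]
  simp only [dotProduct_add, add_dotProduct, dotProduct_smul, smul_dotProduct, smul_eq_mul,
    dotProduct_comm (Fin.tail v) (Fin.tail u)]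
  have c := dotProduct_sq_le (Fin.tail u) (Fin.tail v)
  have ns := dotProduct_self_nonneg' (u 0 • Fin.tail v - v 0 • Fin.tail u)
  simp only [dotProduct_sub, sub_dotProduct, dotProduct_smul, smul_dotProduct, smul_eq_mul,
    dotProduct_comm (Fin.tail v) (Fin.tail u)] at ns
  nlinarith [sq_nonneg (u 0 * v 0 - Fin.tail u ⬝ᵥ Fin.tail v)]

/-- The distance of `T_x s` to a multiple of the unit does not increase when `T_x s` is replaced
by the Jordan product of a scaled pair. -/
theorem scaleBlock_sub_sq_le {x xt s : Fin (m + 1) → ℝ} (hx : PosBlock x) (hxt : PosBlock xt)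
    (c : ℝ) :
    (scaleBlock (scaleBlock x *ᵥ xt) *ᵥ s - c • unitBlock) ⬝ᵥ
        (scaleBlock (scaleBlock x *ᵥ xt) *ᵥ s - c • unitBlock)
      ≤ (jordanBlock xt (scaleBlock x *ᵥ s) - c • unitBlock) ⬝ᵥ
        (jordanBlock xt (scaleBlock x *ᵥ s) - c • unitBlock) := by
  -- Writing `st = T_x s`, the vector `w = T_{T_x xt} s` satisfies `w₀ = xt ⬝ᵥ st` and `det w = det
  -- xt * det st`. The leading entries on both sides therefore agree, and comparing the tails
  -- reduces to Cauchy-Schwarz for the tails of `xt` and `st`.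
  have d1 := blockDet_scaleBlock (hx.scale hxt) s
  rw [blockDet_scaleBlock hx, mul_comm (blockDet x), mul_assoc, ← blockDet_scaleBlock hx] at d1
  rw [dotProduct_eq_tail (_ - _), dotProduct_eq_tail (jordanBlock _ _ - _)]
  simp only [tail_sub', tail_smul', tail_unitBlock, smul_zero, sub_zero, Pi.sub_apply,
    scaleBlock_mulVec_zero, jordanBlock_zero, ← scaleBlock_symm, tail_jordanBlock]
  have hst : x ⬝ᵥ s = (scaleBlock x *ᵥ s) 0 := by simp
  have hsym : (scaleBlock x *ᵥ xt) ⬝ᵥ s = xt ⬝ᵥ (scaleBlock x *ᵥ s) :=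
    (scaleBlock_symm _ _ _).symm
  simp only [blockDet, scaleBlock_mulVec_zero, hsym] at d1
  rw [hst] at d1
  generalize scaleBlock (scaleBlock x *ᵥ xt) *ᵥ s = w at *
  generalize scaleBlock x *ᵥ s = st at *
  have c1 := dotProduct_sq_le (Fin.tail xt) (Fin.tail st)
  rw [dotProduct_eq_tail xt st] at d1
  simp only [dotProduct_add, add_dotProduct, dotProduct_smul, smul_dotProduct, smul_eq_mul,
    dotProduct_comm (Fin.tail st) (Fin.tail xt), hst]
  nlinarith

/-- For a block of dimension at least two, the distance from `c e` to the boundary of the cone is `c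
/ √2`. -/
theorem posBlock_of_near_unit {v : Fin (m + 1) → ℝ} {c : ℝ} (hc : 0 < c)
    (h : 2 * ((v - c • unitBlock) ⬝ᵥ (v - c • unitBlock)) < c ^ 2) : PosBlock v := by
  rw [dotProduct_eq_tail] at h
  simp only [tail_sub', tail_smul', tail_unitBlock, smul_zero, sub_zero, Pi.sub_apply,
    Pi.smul_apply, Pi.single_eq_same, smul_eq_mul, mul_one] at h
  have hn := dotProduct_self_nonneg' (Fin.tail v)
  rw [PosBlock]
  constructor
  · nlinarith [sq_nonneg (v 0)]
  · nlinarith [sq_nonneg (2 * v 0 - c)]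

end Block

/-! ### Assembling the blocks: norms, Jordan product and interior of the product cone. -/

section Global

variable {k : ℕ} {d : Fin k → ℕ}

@[simp] theorem block_ofBlocks (f : (i : Fin k) → Fin (d i + 1) → ℝ) (i : Fin k) :
    block (ofBlocks f) i = f i := rfl

theorem vec_ext {u v : Vec d} (h : ∀ i, block u i = block v i) : u = v :=
  funext fun j => congrFun (h j.1) j.2

theorem block_add (u v : Vec d) (i : Fin k) : block (u + v) i = block u i + block v i := rfl
theorem block_sub (u v : Vec d) (i : Fin k) : block (u - v) i = block u i - block v i := rfl
theorem block_smul (c : ℝ) (v : Vec d) (i : Fin k) : block (c • v) i = c • block v i := rfl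
theorem block_unitVec (i : Fin k) : block (unitVec d) i = unitBlock := rfl
theorem block_jordan (u v : Vec d) (i : Fin k) :
    block (jordan u v) i = jordanBlock (block u i) (block v i) := rfl

theorem dotProduct_eq_sum_block (u v : Vec d) : u ⬝ᵥ v = ∑ i, block u i ⬝ᵥ block v i := by
  simp [dotProduct, Fintype.sum_sigma, block]

theorem block_blockDiagonal'_mulVec
    (M : (i : Fin k) → Matrix (Fin (d i + 1)) (Fin (d i + 1)) ℝ) (v : Vec d) (i : Fin k) :
    block (blockDiagonal' M *ᵥ v) i = M i *ᵥ block v i := by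
  ext a
  simp only [block, mulVec, dotProduct, Fintype.sum_sigma]
  rw [Finset.sum_eq_single i]
  · simp
  · intro j _ hj
    exact Finset.sum_eq_zero fun b _ => by
      rw [blockDiagonal'_apply_ne _ _ _ hj.symm, zero_mul]
  · simp

theorem block_wVec (x s : Vec d) (i : Fin k) :
    block (wVec x s) i = scaleBlock (block x i) *ᵥ block s i :=
  block_blockDiagonal'_mulVec _ _ _

theorem arrow_mulVec (u v : Vec d) : arrow u *ᵥ v = jordan u v :=
  vec_ext fun i => by
    rw [arrow, block_blockDiagonal'_mulVec, arrowBlock_mulVec, block_jordan]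

theorem wVec_add (x u v : Vec d) : wVec x (u + v) = wVec x u + wVec x v := mulVec_add _ _ _
theorem wVec_smul (x : Vec d) (c : ℝ) (v : Vec d) : wVec x (c • v) = c • wVec x v :=
  mulVec_smul _ _ _

theorem wVec_unitVec (x : Vec d) : wVec x (unitVec d) = x :=
  vec_ext fun i => by rw [block_wVec, block_unitVec, scaleBlock_mulVec_unit]

theorem dotProduct_wVec (x u v : Vec d) : u ⬝ᵥ wVec x v = wVec x u ⬝ᵥ v := by
  simp only [dotProduct_eq_sum_block, block_wVec, scaleBlock_symm]

theorem jordan_add_right (u v w : Vec d) : jordan u (v + w) = jordan u v + jordan u w := by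
  simp only [← arrow_mulVec, mulVec_add]

theorem jordan_smul_right (c : ℝ) (u v : Vec d) : jordan u (c • v) = c • jordan u v := by
  simp only [← arrow_mulVec, mulVec_smul]

theorem jordan_comm (u v : Vec d) : jordan u v = jordan v u :=
  vec_ext fun i => by rw [block_jordan, block_jordan, jordanBlock_comm]

theorem jordan_unitVec (u : Vec d) : jordan u (unitVec d) = u :=
  vec_ext fun i => by
    rw [block_jordan, block_unitVec]
    apply block_ext
    · simp
    · simp [tail_unitBlock]

theorem unitVec_dotProduct (v : Vec d) : unitVec d ⬝ᵥ v = ∑ i, block v i 0 := by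
  simp [dotProduct_eq_sum_block, block_unitVec]

theorem unitVec_dotProduct_self : unitVec d ⬝ᵥ unitVec d = k := by
  simp [unitVec_dotProduct, block_unitVec]

theorem unitVec_dotProduct_jordan (u v : Vec d) : unitVec d ⬝ᵥ jordan u v = u ⬝ᵥ v := by
  simp [unitVec_dotProduct, block_jordan, dotProduct_eq_sum_block u v]

theorem unitVec_dotProduct_wVec (x s : Vec d) : unitVec d ⬝ᵥ wVec x s = x ⬝ᵥ s := by
  rw [dotProduct_wVec, wVec_unitVec]

theorem block_sq_le (v : Vec d) (i : Fin k) : block v i ⬝ᵥ block v i ≤ eucNorm v ^ 2 := by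
  rw [eucNorm_sq, dotProduct_eq_sum_block]
  exact Finset.single_le_sum (f := fun i => block v i ⬝ᵥ block v i)
    (fun i _ => dotProduct_self_nonneg' _) (Finset.mem_univ i)

/-- A vector each of whose blocks is dominated by a product of blocks. -/
theorem eucNorm_le_of_block_sq_le {c : ℝ} (hc : 0 ≤ c) (u v w : Vec d)
    (h : ∀ i, block w i ⬝ᵥ block w i ≤
      c ^ 2 * ((block u i ⬝ᵥ block u i) * (block v i ⬝ᵥ block v i))) :
    eucNorm w ≤ c * (eucNorm u * eucNorm v) := by
  refine le_of_sq_le_sq ?_ (mul_nonneg hc (mul_nonneg (eucNorm_nonneg _) (eucNorm_nonneg _)))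
  rw [mul_pow, mul_pow, eucNorm_sq w, eucNorm_sq u, dotProduct_eq_sum_block w,
    dotProduct_eq_sum_block u, Finset.sum_mul, Finset.mul_sum]
  refine Finset.sum_le_sum fun i _ => (h i).trans ?_
  exact mul_le_mul_of_nonneg_left
    (mul_le_mul_of_nonneg_left (block_sq_le v i) (dotProduct_self_nonneg' _)) (sq_nonneg c)

theorem eucNorm_jordan_le (u v : Vec d) :
    eucNorm (jordan u v) ≤ √2 * (eucNorm u * eucNorm v) :=
  eucNorm_le_of_block_sq_le (Real.sqrt_nonneg 2) u v _ fun i => by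
    rw [Real.sq_sqrt zero_le_two]
    exact jordanBlock_sq_le (block u i) (block v i)

/-- Points in the interior of the product cone. -/
def PosVec (v : Vec d) : Prop := ∀ i, PosBlock (block v i)

theorem PosVec.scale {x v : Vec d} (hx : PosVec x) (hv : PosVec v) : PosVec (wVec x v) :=
  fun i => by rw [block_wVec]; exact (hx i).scale (hv i)

theorem PosVec.of_scale {x v : Vec d} (hx : PosVec x) (hv : PosVec (wVec x v)) : PosVec v :=
  fun i => (hx i).of_scale (by rw [← block_wVec]; exact hv i)

theorem PosVec.dotProduct_pos (hk : 0 < k) {x v : Vec d} (hx : PosVec x) (hv : PosVec v) :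
    0 < x ⬝ᵥ v := by
  rw [dotProduct_eq_sum_block]
  exact Finset.sum_pos (fun i _ => (hx i).dotProduct_pos (hv i)) ⟨⟨0, hk⟩, Finset.mem_univ _⟩

theorem PosVec.exists_wVec_eq {x : Vec d} (hx : PosVec x) (v : Vec d) : ∃ u, wVec x u = v := by
  choose f hf using fun i => exists_scaleBlock_mulVec_eq (hx i) (block v i)
  exact ⟨ofBlocks f, vec_ext fun i => by rw [block_wVec, block_ofBlocks, hf]⟩

theorem posVec_of_near_unit {v : Vec d} {c : ℝ} (hc : 0 < c)
    (h : √2 * eucNorm (v - c • unitVec d) < c) : PosVec v := fun i => by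
  refine posBlock_of_near_unit hc (lt_of_le_of_lt ?_
    (pow_lt_pow_left₀ h (mul_nonneg (Real.sqrt_nonneg 2) (eucNorm_nonneg _)) two_ne_zero))
  rw [mul_pow, Real.sq_sqrt zero_le_two]
  exact mul_le_mul_of_nonneg_left (block_sq_le (v - c • unitVec d) i) zero_le_two

theorem mem_interior_cone {v : Vec d} : v ∈ interior (cone d) ↔ PosVec v := by
  constructor
  · intro hv i
    -- For an interior point `v`, some `v - ε e` with `ε > 0` still lies in the cone, which makes
    -- the inequality for `v` strict.
    have ht : Filter.Tendsto (fun ε : ℝ => v - ε • unitVec d) (nhdsWithin 0 (Set.Ioi 0))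
        (nhds v) := by
      have : Continuous fun ε : ℝ => v - ε • unitVec d := by fun_prop
      simpa using (this.tendsto 0).mono_left nhdsWithin_le_nhds
    obtain ⟨ε, h1, h2⟩ := ((ht.eventually (mem_interior_iff_mem_nhds.1 hv)).and
      self_mem_nhdsWithin).exists
    have h3 := h1 i
    rw [← eucNorm_tail_lt_iff]
    simp only [soCone, Set.mem_ofPred_eq, block_sub, block_smul, block_unitVec, tail_sub',
      tail_smul', tail_unitBlock, smul_zero, sub_zero, Pi.sub_apply, Pi.smul_apply,
      Pi.single_eq_same, smul_eq_mul, mul_one] at h3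
    have h4 : 0 < ε := h2
    linarith
  · intro hv
    have ho : IsOpen {v : Vec d | PosVec v} := by
      simp only [PosVec, Set.ofPred_forall]
      refine isOpen_iInter_of_finite fun i => ?_
      simp only [PosBlock, Set.ofPred_and]
      refine IsOpen.inter (isOpen_lt continuous_const ?_) (isOpen_lt ?_ ?_)
      · exact continuous_apply (⟨i, 0⟩ : Idx d)
      · simp only [dotProduct, Fin.tail, block]
        fun_prop
      · simp only [block]
        fun_prop
    refine interior_maximal (fun u hu i => ?_) ho hv
    exact ((eucNorm_tail_lt_iff _).2 (hu i)).le

theorem mem_interior_fullCone {p : ℕ} {z : Point d p} :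
    z ∈ interior (fullCone d p) ↔ PosVec z.1 ∧ PosVec z.2.2 := by
  simp [fullCone, interior_prod_eq, mem_interior_cone]

/-- Invariance of the central path distance under scaling, and comparison with the
Jordan product. -/
theorem eucNorm_wVec_sub_le {x xt s : Vec d} (hx : PosVec x) (hxt : PosVec xt) (c : ℝ) :
    eucNorm (wVec (wVec x xt) s - c • unitVec d) ≤
      eucNorm (jordan xt (wVec x s) - c • unitVec d) := by
  refine le_of_sq_le_sq ?_ (eucNorm_nonneg _)
  rw [eucNorm_sq, eucNorm_sq, dotProduct_eq_sum_block, dotProduct_eq_sum_block]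
  refine Finset.sum_le_sum fun i _ => ?_
  simp only [block_sub, block_smul, block_unitVec, block_wVec, block_jordan]
  exact scaleBlock_sub_sq_le (hx i) (hxt i) c

/-- The scaled residual of the linearized complementarity equation is of second order. -/
theorem eucNorm_scaled_residual_le {x : Vec d} (hx : PosVec x) (u s t : Vec d) (c b : ℝ)
    (h : jordan x t + jordan s (wVec x u) = c • unitVec d - jordan x s) :
    eucNorm (wVec x s + wVec x t + jordan u (wVec x s) - c • unitVec d) ≤
      2 * (eucNorm u * eucNorm (wVec x s - b • unitVec d)) := by
  refine eucNorm_le_of_block_sq_le zero_le_two _ _ _ fun i => ?_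
  have hi := congrArg (block · i) h
  simp only [block_sub, block_smul, block_unitVec, block_wVec, block_jordan, block_add] at hi ⊢
  have key := scaled_residual_sq_le (hx i) _ _ _ c hi _ rfl
  refine key.trans ?_
  rw [show (2 : ℝ) ^ 2 = 4 by norm_num, ← mul_assoc]
  refine mul_le_mul_of_nonneg_left ?_
    (mul_nonneg zero_le_four (dotProduct_self_nonneg' _))
  -- Only the tail of `w` enters the bound, and subtracting `b e` leaves tails unchanged; hence `b`
  -- is arbitrary.
  rw [dotProduct_eq_tail (_ - _)]
  simp only [tail_sub', tail_smul', tail_unitBlock, smul_zero, sub_zero]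
  exact le_add_of_nonneg_left (mul_self_nonneg _)

end Global

/-! ### Linear identities along the search direction. -/

section Step

variable {k p : ℕ} {d : Fin k → ℕ}

theorem dotProduct_skew_mulVec {ι : Type*} [Fintype ι] {C : Matrix ι ι ℝ} (hC : C = -Cᵀ)
    (u : ι → ℝ) : u ⬝ᵥ C *ᵥ u = 0 := by
  have h : u ⬝ᵥ C *ᵥ u = -(u ⬝ᵥ C *ᵥ u) := by
    conv_lhs => rw [hC, neg_mulVec, dotProduct_neg, mulVec_transpose, dotProduct_comm,
      ← dotProduct_mulVec]
  linarith

namespace IsDirection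

variable {A : Matrix (Fin p) (Idx d) ℝ} {C D : Matrix (Idx d) (Idx d) ℝ} {ν : ℝ}
  {z Δz : Point d p}

theorem resP_step (h : IsDirection A C D ν z Δz) (α : ℝ) :
    resP A (z + α • Δz) = (1 - α * (1 - ν)) • resP A z := by
  simp only [resP, Prod.fst_add, Prod.smul_fst, mulVec_add, mulVec_smul, h.primal]
  module

theorem resD_step (h : IsDirection A C D ν z Δz) (α : ℝ) :
    resD A C (z + α • Δz) = (1 - α * (1 - ν)) • resD A C z := by
  have : resD A C (z + α • Δz) = resD A C z
      + α • (Aᵀ *ᵥ Δz.2.1 + C *ᵥ Δz.1 + Δz.2.2) := by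
    simp only [resD, Prod.fst_add, Prod.smul_fst, Prod.snd_add, Prod.smul_snd, mulVec_add,
      mulVec_smul]
    module
  rw [this, h.dual, resD]
  module

theorem compl_one (h : IsDirection A C 1 ν z Δz) :
    jordan z.1 Δz.2.2 + jordan z.2.2 Δz.1
      = (ν * mu z.1 z.2.2) • unitVec d - jordan z.1 z.2.2 := by
  simpa [arrow_mulVec] using h.compl

theorem dotProduct_add_dotProduct (hk : 0 < k) (h : IsDirection A C 1 ν z Δz) :
    z.1 ⬝ᵥ Δz.2.2 + z.2.2 ⬝ᵥ Δz.1 = -(1 - ν) * (z.1 ⬝ᵥ z.2.2) := by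
  have h1 := congrArg (unitVec d ⬝ᵥ ·) h.compl_one
  have hk' : (k : ℝ) ≠ 0 := by positivity
  simp only [dotProduct_add, dotProduct_sub, unitVec_dotProduct_jordan, dotProduct_smul,
    unitVec_dotProduct_self, smul_eq_mul, mu] at h1
  rw [h1]
  field_simp
  ring

/-- The shifted direction `Δz + (1 - ν) z` solves the homogeneous primal and dual equations, so its
`x` and `s` parts are orthogonal by skew-symmetry of `C`. Expanding this and inserting the unit
component of the complementarity equation leaves only `Δx ⬝ᵥ Δs`. -/
theorem dotProduct_eq_zero (hk : 0 < k) (hC : C = -Cᵀ) (h : IsDirection A C 1 ν z Δz) :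
    Δz.1 ⬝ᵥ Δz.2.2 = 0 := by
  have hs := h.dotProduct_add_dotProduct hk
  have hp : A *ᵥ (Δz.1 + (1 - ν) • z.1) = 0 := by
    rw [mulVec_add, mulVec_smul, h.primal]; module
  have hd : Aᵀ *ᵥ (Δz.2.1 + (1 - ν) • z.2.1) + C *ᵥ (Δz.1 + (1 - ν) • z.1)
      + (Δz.2.2 + (1 - ν) • z.2.2) = 0 := by
    have := h.dual
    simp only [mulVec_add, mulVec_smul]
    linear_combination (norm := module) this
  have h1 := congrArg ((Δz.1 + (1 - ν) • z.1) ⬝ᵥ ·) hd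
  simp only [dotProduct_add _ (_ + _) (Δz.2.2 + _), dotProduct_add _ (Aᵀ *ᵥ _)] at h1
  rw [dotProduct_skew_mulVec hC, mulVec_transpose, dotProduct_comm _ (_ ᵥ* A),
    ← dotProduct_mulVec, hp] at h1
  simp only [dotProduct_zero, dotProduct_add, add_dotProduct, dotProduct_smul, smul_dotProduct,
    smul_eq_mul, dotProduct_comm Δz.1 z.2.2] at h1
  linear_combination h1 - (1 - ν) * hs

theorem mu_step (hk : 0 < k) (hC : C = -Cᵀ) (h : IsDirection A C 1 ν z Δz) (α : ℝ) :
    mu (z + α • Δz).1 (z + α • Δz).2.2 = (1 - α * (1 - ν)) * mu z.1 z.2.2 := by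
  have h1 := h.dotProduct_add_dotProduct hk
  have h2 := h.dotProduct_eq_zero hk hC
  simp only [mu, Prod.fst_add, Prod.smul_fst, Prod.snd_add, Prod.smul_snd, dotProduct_add,
    add_dotProduct, dotProduct_smul, smul_dotProduct, smul_eq_mul, h2,
    dotProduct_comm Δz.1 z.2.2]
  rw [← mul_div_assoc]
  congr 1
  linear_combination α * h1

end IsDirection

/-! ### Size of the scaled direction and the estimate at the new point. -/

theorem mul_eucNorm_le_of_sq {c t : ℝ} (ht : 0 ≤ t) {v : Vec d}
    (h : c ^ 2 * eucNorm v ^ 2 ≤ t ^ 2) : c * eucNorm v ≤ t :=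
  le_of_sq_le_sq (by rwa [mul_pow]) ht

/-- Size of the scaled direction: if `v + μ u` is, up to terms of second order, a vector of norm
at most `H`, and `u ⊥ v`, then `‖v‖² + μ² ‖u‖²` is at most `H² / (1 - 3 γ)²`. -/
theorem scaled_direction_bound {u v G R F : Vec d} {γ μ H : ℝ}
    (hγ0 : 0 < γ) (hγ : γ < 1 / 3) (huv : u ⬝ᵥ v = 0)
    (hG : √2 * eucNorm G ≤ γ * μ) (hR : eucNorm R ≤ 2 * (eucNorm u * eucNorm G))
    (hF : eucNorm F ≤ H) (hE : v + μ • u = R + ((-1 : ℝ) • jordan u G + (-1 : ℝ) • F)) :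
    (1 - 3 * γ) ^ 2 * (eucNorm v ^ 2 + μ ^ 2 * eucNorm u ^ 2) ≤ H ^ 2 := by
  have hn : eucNorm (v + μ • u) ^ 2 = eucNorm v ^ 2 + μ ^ 2 * eucNorm u ^ 2 := by
    simp only [eucNorm_sq, dotProduct_add, add_dotProduct, dotProduct_smul, smul_dotProduct,
      smul_eq_mul, dotProduct_comm v u, huv]
    ring
  have h0 := eucNorm_nonneg (v + μ • u)
  have hu := eucNorm_nonneg u
  have hg := eucNorm_nonneg G
  have hμa : μ * eucNorm u ≤ eucNorm (v + μ • u) :=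
    le_of_sq_le_sq (by rw [hn, mul_pow]; linarith [sq_nonneg (eucNorm v)]) h0
  have hle : eucNorm (v + μ • u) ≤ eucNorm R + (eucNorm (jordan u G) + eucNorm F) := by
    conv_lhs => rw [hE]
    refine (eucNorm_add_le _ _).trans (add_le_add_right ((eucNorm_add_le _ _).trans ?_) _)
    rw [eucNorm_smul, eucNorm_smul, abs_neg, abs_one, one_mul, one_mul]
  have hj := eucNorm_jordan_le u G
  have hs : √2 ^ 2 = 2 := Real.sq_sqrt zero_le_two
  -- `R` contributes at most `√2 γ μ ‖u‖` and `u ∘ G` at most `γ μ ‖u‖`; rounding `√2` up to `3/2`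
  -- gives `5/2`, which is below the `3` in `1 - 3γ`.
  have hs1 : √2 ≤ 3 / 2 := by
    rw [Real.sqrt_le_left (by norm_num)]; norm_num
  have hs0 : 0 ≤ √2 := Real.sqrt_nonneg 2
  have e1 : √2 * (eucNorm u * eucNorm G) ≤ γ * (μ * eucNorm u) := by
    nlinarith [mul_le_mul_of_nonneg_left hG hu]
  have e2 : 2 * (eucNorm u * eucNorm G) ≤ 3 / 2 * (γ * (μ * eucNorm u)) := by
    have : 2 * (eucNorm u * eucNorm G) = √2 * (√2 * (eucNorm u * eucNorm G)) := by
      rw [← mul_assoc √2, ← pow_two, hs]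
    rw [this]
    exact mul_le_mul hs1 e1 (by positivity) (by norm_num)
  have e3 : γ * (μ * eucNorm u) ≤ γ * eucNorm (v + μ • u) :=
    mul_le_mul_of_nonneg_left hμa hγ0.le
  have e4 : (1 - 3 * γ) * eucNorm (v + μ • u) ≤ H := by
    have : 0 ≤ γ * eucNorm (v + μ • u) := by positivity
    linarith
  rw [← hn, ← mul_pow]
  exact pow_le_pow_left₀ (mul_nonneg (by linarith) h0) e4 2

/-- The numerical consequences of `Γ̃ < γ`, with `a = ‖u‖` and `b = ‖v‖`. The factor `8` is the `4`
in `Γ̃` times the `2` from `(γ² + δ²) / 2`. -/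
theorem direction_scalar_bounds {γ δ ν μ a b : ℝ} (hμ : 0 < μ) (hγ0 : 0 < γ)
    (hγ1 : γ < 1 / 3) (hν0 : 0 < ν) (hν1 : ν < 1)
    (hΓ : 4 * (γ ^ 2 + δ ^ 2) < γ * ν * (1 - 3 * γ) ^ 2)
    (hdir : (1 - 3 * γ) ^ 2 * (b ^ 2 + μ ^ 2 * a ^ 2) ≤ (γ ^ 2 + δ ^ 2) / 2 * μ ^ 2) :
    8 * (b ^ 2 + μ ^ 2 * a ^ 2) ≤ γ * ν * μ ^ 2 ∧ γ * ν < 1 / 3 ∧ 4 * γ ^ 2 ≤ γ * ν ∧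
      8 * a ^ 2 ≤ γ * ν ∧ 8 * b ^ 2 ≤ γ * ν * μ ^ 2 := by
  have hq : 0 < (1 - 3 * γ) ^ 2 := pow_pos (by linarith) 2
  have hq1 : (1 - 3 * γ) ^ 2 ≤ 1 := by nlinarith
  have hn : 8 * (b ^ 2 + μ ^ 2 * a ^ 2) ≤ γ * ν * μ ^ 2 := by
    have : (1 - 3 * γ) ^ 2 * (8 * (b ^ 2 + μ ^ 2 * a ^ 2))
        ≤ (1 - 3 * γ) ^ 2 * (γ * ν * μ ^ 2) := by
      nlinarith [mul_lt_mul_of_pos_right hΓ (pow_pos hμ 2)]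
    exact le_of_mul_le_mul_left this hq
  have hγν : 0 < γ * ν := mul_pos hγ0 hν0
  have hγν3 : γ * ν < 1 / 3 := by nlinarith
  have hγ2 : 4 * γ ^ 2 ≤ γ * ν := by
    nlinarith only [sq_nonneg δ, hΓ,
      mul_le_mul_of_nonneg_left hq1 hγν.le]
  have ha : 8 * a ^ 2 ≤ γ * ν := by
    have : μ ^ 2 * (8 * a ^ 2) ≤ μ ^ 2 * (γ * ν) := by
      nlinarith [sq_nonneg (b)]
    exact le_of_mul_le_mul_left this (pow_pos hμ 2)
  have hb : 8 * b ^ 2 ≤ γ * ν * μ ^ 2 := by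
    nlinarith [mul_nonneg (sq_nonneg μ) (sq_nonneg (a))]
  exact ⟨hn, hγν3, hγ2, ha, hb⟩

theorem mem_nbhd₂_step (hk : 0 < k) {A : Matrix (Fin p) (Idx d) ℝ}
    {C : Matrix (Idx d) (Idx d) ℝ} (hC : C = -Cᵀ) {γ δ ν α : ℝ} (hγ : γ ∈ Set.Ioo (0 : ℝ) (1 / 3))
    (hα : α ∈ Set.Icc (0 : ℝ) 1) (hν1 : ν < 1) (hν0 : 0 < ν)
    (hνδ : (1 - ν) ^ 2 * k = δ ^ 2 / 2)
    (hΓ : 4 * (γ ^ 2 + δ ^ 2) < γ * ν * (1 - 3 * γ) ^ 2)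
    {z Δz : Point d p} (hz : z ∈ nbhd₂ d p γ) (hΔ : IsDirection A C 1 ν z Δz) :
    z + α • Δz ∈ nbhd₂ d p γ := by
  obtain ⟨hz1, hz2⟩ := hz
  obtain ⟨hx, hs⟩ := mem_interior_fullCone.1 hz1
  obtain ⟨hγ0, hγ1⟩ := hγ
  obtain ⟨hα0, hα1⟩ := hα
  have hmu := hΔ.mu_step hk hC α
  have horth := hΔ.dotProduct_eq_zero hk hC
  have hcomp := hΔ.compl_one
  have hk' : (0 : ℝ) < k := Nat.cast_pos.2 hk
  have hμ : 0 < mu z.1 z.2.2 := div_pos (hx.dotProduct_pos hk hs) hk'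
  have hμk : z.1 ⬝ᵥ z.2.2 = mu z.1 z.2.2 * k := by rw [mu]; field_simp
  obtain ⟨x, y, s⟩ := z
  obtain ⟨dx, dy, ds⟩ := Δz
  simp only [Prod.fst_add, Prod.smul_fst, Prod.snd_add, Prod.smul_snd, dist₂] at *
  generalize mu x s = μ at *
  obtain ⟨u, rfl⟩ := hx.exists_wVec_eq dx
  set w := wVec x s with hw
  set v := wVec x ds with hv
  set G := w - μ • unitVec d with hG
  have hwG : w = G + μ • unitVec d := by rw [hG]; abel
  set R := w + v + jordan u w - (ν * μ) • unitVec d with hR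
  have hRle : eucNorm R ≤ 2 * (eucNorm u * eucNorm G) :=
    eucNorm_scaled_residual_le hx u s ds (ν * μ) μ hcomp
  have huv : u ⬝ᵥ v = 0 := by rw [hv, dotProduct_wVec, horth]
  have hjw : jordan u w = jordan u G + μ • u := by
    rw [hwG, jordan_add_right, jordan_smul_right, jordan_unitVec]
  set F := G + ((1 - ν) * μ) • unitVec d with hF
  have hE : v + μ • u = R + ((-1 : ℝ) • jordan u G + (-1 : ℝ) • F) := by
    rw [hR, hjw, hF, hwG]; module
  have heG : unitVec d ⬝ᵥ G = 0 := by
    rw [hG, dotProduct_sub, hw, unitVec_dotProduct_wVec, dotProduct_smul,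
      unitVec_dotProduct_self, hμk, smul_eq_mul, sub_self]
  have hs2 : √2 ^ 2 = 2 := Real.sq_sqrt zero_le_two
  have hs0 : 0 ≤ √2 := Real.sqrt_nonneg 2
  have hG2 : 2 * eucNorm G ^ 2 ≤ (γ * μ) ^ 2 := by
    rw [← hs2, ← mul_pow]
    exact pow_le_pow_left₀ (mul_nonneg hs0 (eucNorm_nonneg _)) hz2 2
  -- `G ⊥ e`, so Pythagoras applies with `‖e‖² = k`; the choice of `ν` makes `(1 - ν)² k = δ² / 2`.
  have hF2 : eucNorm F ^ 2 ≤ (γ ^ 2 + δ ^ 2) / 2 * μ ^ 2 := by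
    have : eucNorm F ^ 2 = eucNorm G ^ 2 + ((1 - ν) ^ 2 * k) * μ ^ 2 := by
      simp only [eucNorm_sq, hF, dotProduct_add, add_dotProduct, dotProduct_smul,
        smul_dotProduct, smul_eq_mul, dotProduct_comm G, heG, unitVec_dotProduct_self]
      ring
    rw [this, hνδ]
    linarith only [hG2]
  have hdir := (scaled_direction_bound hγ0 hγ1 huv hz2 hRle le_rfl hE).trans hF2
  have hu0 := eucNorm_nonneg u
  have hv0 := eucNorm_nonneg v
  have hg0 := eucNorm_nonneg G
  obtain ⟨hn, hγν3, hγ2, ha, hb⟩ := direction_scalar_bounds hμ hγ0 hγ1 hν0 hν1 hΓ hdir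
  have hγν : 0 < γ * ν := mul_pos hγ0 hν0
  have hxt : PosVec (unitVec d + α • u) := by
    refine posVec_of_near_unit one_pos ?_
    have e : unitVec d + α • u - (1 : ℝ) • unitVec d = α • u := by module
    rw [e, eucNorm_smul, abs_of_nonneg hα0]
    have h1 : √2 * eucNorm u ≤ 2 / 3 :=
      mul_eucNorm_le_of_sq (by norm_num) (by rw [hs2]; linarith only [ha, hγν3])
    have h2 : α * (√2 * eucNorm u) ≤ √2 * eucNorm u :=
      mul_le_of_le_one_left (by positivity) hα1
    linarith only [h1, h2]
  have hst : PosVec (w + α • v) := by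
    refine posVec_of_near_unit hμ ?_
    have e : w + α • v - μ • unitVec d = G + α • v := by rw [hG]; module
    have h1 : √2 * eucNorm v ≤ 1 / 2 * μ :=
      mul_eucNorm_le_of_sq (by positivity) 
        (by rw [hs2]; nlinarith only [pow_pos hμ 2, hb, hγν3])
    have h2 := eucNorm_add_le G (α • v)
    rw [eucNorm_smul, abs_of_nonneg hα0] at h2
    rw [e]
    have h3 : α * (√2 * eucNorm v) ≤ √2 * eucNorm v :=
      mul_le_of_le_one_left (by positivity) hα1
    nlinarith only [mul_le_mul_of_nonneg_left h2 hs0, h1, h3, hz2, hγ1, hμ]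
  have hxeq : x + α • wVec x u = wVec x (unitVec d + α • u) := by
    rw [wVec_add, wVec_smul, wVec_unitVec]
  have hseq : wVec x (s + α • ds) = w + α • v := by rw [wVec_add, wVec_smul]
  refine ⟨mem_interior_fullCone.2 ⟨?_, ?_⟩, ?_⟩
  · change PosVec (x + α • wVec x u)
    rw [hxeq]
    exact hx.scale hxt
  · exact hx.of_scale (by rw [← hseq] at hst; exact hst)
  · change √2 * eucNorm (wVec (x + α • wVec x u) (s + α • ds)
        - mu (x + α • wVec x u) (s + α • ds) • unitVec d)
      ≤ γ * mu (x + α • wVec x u) (s + α • ds)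
    rw [hmu, hxeq]
    have hcmp := eucNorm_wVec_sub_le (s := s + α • ds) hx hxt ((1 - α * (1 - ν)) * μ)
    -- The first-order terms combine into `G` and `R`, leaving `u ∘ v` as the only quadratic term.
    have hexp : jordan (unitVec d + α • u) (wVec x (s + α • ds))
        - ((1 - α * (1 - ν)) * μ) • unitVec d
        = (1 - α) • G + (α • R + (α ^ 2) • jordan u v) := by
      rw [hseq, jordan_comm, jordan_add_right, jordan_unitVec, jordan_smul_right, jordan_comm,
        jordan_add_right, jordan_smul_right, hR, hG]
      module
    rw [hexp] at hcmp
    have t1 := eucNorm_add_le ((1 - α) • G) (α • R + (α ^ 2) • jordan u v)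
    have t2 := eucNorm_add_le (α • R) ((α ^ 2) • jordan u v)
    rw [eucNorm_smul, abs_of_nonneg (sub_nonneg.2 hα1)] at t1
    rw [eucNorm_smul, eucNorm_smul, abs_of_nonneg hα0, abs_of_nonneg (sq_nonneg α)] at t2
    have t3 := eucNorm_jordan_le u v
    have s1 : √2 * eucNorm R ≤ (γ ^ 2 + eucNorm u ^ 2) * μ := by
      have : √2 * eucNorm R ≤ 2 * (eucNorm u * (γ * μ)) := by
        nlinarith only [mul_le_mul_of_nonneg_left hRle hs0, mul_le_mul_of_nonneg_left hz2 hu0]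
      -- AM-GM: `2 γ ‖u‖ ≤ γ² + ‖u‖²`.
      nlinarith only [this, mul_nonneg hμ.le (sq_nonneg (γ - eucNorm u))]
    have s2 : √2 * eucNorm (jordan u v) ≤ γ * ν / 8 * μ := by
      have h1 : √2 * eucNorm (jordan u v) ≤ 2 * (eucNorm u * eucNorm v) := by
        have := mul_le_mul_of_nonneg_left t3 hs0
        rwa [← mul_assoc √2, ← pow_two, hs2] at this
      have h2 : μ * (2 * (eucNorm u * eucNorm v)) ≤ μ * (γ * ν / 8 * μ) := by
        nlinarith only [hn, sq_nonneg (eucNorm v - μ * eucNorm u)]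
      exact h1.trans (le_of_mul_le_mul_left h2 hμ)
    -- Here `γ² ≤ γν/4` and `‖u‖² ≤ γν/8` give `3/8`. With the `1/8` from `u ∘ v` the total is `(1 -
    -- α) γ μ + α γ ν μ / 2`, below the allowed `γ (1 - α + α ν) μ`.
    have s3 : α * (√2 * eucNorm R) ≤ α * (3 / 8 * (γ * ν) * μ) :=
      mul_le_mul_of_nonneg_left (s1.trans
        (mul_le_mul_of_nonneg_right (by linarith only [hγ2, ha]) hμ.le)) hα0
    have s4 : α ^ 2 * (√2 * eucNorm (jordan u v)) ≤ α * (γ * ν / 8 * μ) :=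
      mul_le_mul (by nlinarith only [hα0, hα1]) s2 (mul_nonneg hs0 (eucNorm_nonneg _)) hα0
    have s5 : (1 - α) * (√2 * eucNorm G) ≤ (1 - α) * (γ * μ) :=
      mul_le_mul_of_nonneg_left hz2 (sub_nonneg.2 hα1)
    have s6 : 0 ≤ α * (γ * ν * μ) := by positivity
    have := mul_le_mul_of_nonneg_left (hcmp.trans (t1.trans (add_le_add_right t2 _))) hs0
    linarith only [this, s3, s4, s5, s6]

end Step

end SOCP

end

/-! ### Translating the parameters `δ`, `ν` and `Γ̃` into the inequalities of the step estimate. -/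

theorem theorem4 {k p : ℕ} (hk : 0 < k) (d : Fin k → ℕ)
    (A : Matrix (Fin p) (SOCP.Idx d) ℝ) (hA : A.rank = p)
    (C : Matrix (SOCP.Idx d) (SOCP.Idx d) ℝ) (hC : C = -Cᵀ)
    (γ δ ν α : ℝ) (hγ : γ ∈ Set.Ioo (0 : ℝ) (1 / 3)) (hδ : δ ∈ Set.Ioo (0 : ℝ) 1)
    (hα : α ∈ Set.Icc (0 : ℝ) 1)
    (hΓ : 4 * (γ ^ 2 + δ ^ 2) / (1 - 3 * γ) ^ 2 * (1 - δ / √(2 * (k : ℝ)))⁻¹ < γ)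
    (hν : ν = 1 - δ / √(2 * (k : ℝ)))
    (z Δz : SOCP.Point d p) (hz : z ∈ SOCP.nbhd₂ d p γ)
    (hΔ : SOCP.IsDirection A C 1 ν z Δz) :
    z + α • Δz ∈ SOCP.nbhd₂ d p γ ∧
    SOCP.resP A (z + α • Δz) = (1 - α * δ / √(2 * (k : ℝ))) • SOCP.resP A z ∧
    SOCP.resD A C (z + α • Δz) = (1 - α * δ / √(2 * (k : ℝ))) • SOCP.resD A C z ∧
    SOCP.mu (z + α • Δz).1 (z + α • Δz).2.2
      = (1 - α * δ / √(2 * (k : ℝ))) * SOCP.mu z.1 z.2.2 := by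
  obtain ⟨hδ0, hδ1⟩ := hδ
  have hk1 : (1 : ℝ) ≤ k := Nat.one_le_cast.2 hk
  have hr1 : (1 : ℝ) ≤ √(2 * (k : ℝ)) := Real.one_le_sqrt.2 (by linarith)
  have hr0 : (0 : ℝ) < √(2 * (k : ℝ)) := by linarith
  have hκ : 1 - ν = δ / √(2 * (k : ℝ)) := by rw [hν]; ring
  have hκ0 : 0 < δ / √(2 * (k : ℝ)) := div_pos hδ0 hr0
  have hκ1 : δ / √(2 * (k : ℝ)) < 1 := (div_lt_one hr0).2 (by linarith)
  have hν0 : 0 < ν := by linarith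
  have hstep : 1 - α * δ / √(2 * (k : ℝ)) = 1 - α * (1 - ν) := by rw [hκ, mul_div_assoc]
  have hνδ : (1 - ν) ^ 2 * k = δ ^ 2 / 2 := by
    rw [hκ, div_pow, Real.sq_sqrt (by linarith)]
    field_simp
  have hq : 0 < (1 - 3 * γ) ^ 2 := pow_pos (by linarith [hγ.2]) 2
  rw [← hν, ← div_eq_mul_inv, div_lt_iff₀ hν0, div_lt_iff₀ hq] at hΓ
  rw [hstep]
  exact ⟨SOCP.mem_nbhd₂_step hk hC hγ hα (by linarith) hν0 hνδ hΓ hz hΔ, hΔ.resP_step α,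
    hΔ.resD_step α, hΔ.mu_step hk hC α⟩
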